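/- Let $R$ be an associative ring with identity and let $P$ be a hereditary right $R$-module, i.e. every submodule of $P$ is projective. Recall that a module $Q$ is quasi-injective if every homomorphism from a submodule of $Q$ to $Q$ extends to an endomorphism of $Q$, and that the quasi-injective hull of a module $M$ is the minimal quasi-injective essential extension of $M$ (it is unique up to isomorphism over $M$). Assume that for every cyclic submodule $xR$ of $P$ ($x\in P$), the quasi-injective hull of $xR$ is countably generated. Then there is a family $(N_k)_{k\in I}$ of noetherian submodules of $P$ with $P=\bigoplus_{k\in I}N_k$; moreover, if $P$ is countably generated, then $I$ can be taken countable. -/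

import Mathlib

universe u v w

/-- A module is hereditary when each of its submodules is projective. -/
def IsHereditaryModule (S : Type u) [Ring S] (M : Type v) [AddCommGroup M] [Module S M] : Prop :=
  ∀ N : Submodule S M, Module.Projective S N

/-- A module is countably generated when it has a countable (possibly finite) generating set. -/
def IsCountablyGeneratedModule (S : Type u) [Ring S] (M : Type v) [AddCommGroup M] [Module S M] :
    Prop :=
  ∃ s : Set M, s.Countable ∧ Submodule.span S s = ⊤

/-- A module `M` is quasi-injective when every homomorphism from a submodule of `M` to `M`
extends to an endomorphism of `M`. -/
def IsQuasiInjectiveModule (S : Type u) [Ring S] (M : Type v) [AddCommGroup M] [Module S M] :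
    Prop :=
  ∀ (N : Submodule S M) (f : N →ₗ[S] M), ∃ g : M →ₗ[S] M, ∀ x : N, g x = f x

/-- `i : M → Q` is a quasi-injective hull of `M`: an essential monomorphism into a quasi-injective
module `Q` such that no proper submodule of `Q` containing the image of `M` is quasi-injective
(that is, a minimal quasi-injective essential extension of `M`). -/
structure IsQuasiInjectiveHull {S : Type u} [Ring S] {M : Type v} [AddCommGroup M] [Module S M]
    {Q : Type w} [AddCommGroup Q] [Module S Q] (i : M →ₗ[S] Q) : Prop where
  injective : Function.Injective i
  essential : ∀ N : Submodule S Q, N ⊓ LinearMap.range i = ⊥ → N = ⊥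
  quasiInjective : IsQuasiInjectiveModule S Q
  minimal : ∀ N : Submodule S Q, LinearMap.range i ≤ N → IsQuasiInjectiveModule S N → N = ⊤

/-!
Everything rests on one property of a hereditary module `M`: a map with image in `M` has projective
image, so its kernel is a direct summand and cannot be proper and essential
(`eq_zero_of_essentialIn_ker`). Combined with dual bases it shows that a submodule of `M` needs no
more generators than any of its essential submodules, up to `ℵ₀`
(`IsHereditaryModule.exists_span_eq`). In particular `M` is noetherian as soon as it contains no
infinite direct sum of nonzero submodules.

The heart of the proof is that a cyclic hereditary module `C` with countably generated
quasi-injective hull `Q` contains no infinite direct sum (`not_hasIndepFamily_aleph0`). Minimality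
makes `Q` the sum of the images of `C` under `End Q`. Hence endomorphisms of `Q` with essential
kernel vanish, and `Q` is a quotient of the hereditary module `ℕ →₀ C`, by a kernel `K`, say.
Suppose that `C` contains an infinite direct sum. Independent families in `ℕ →₀ C` are no larger
than suitable ones in `C`; for sizes of countable cofinality this needs a version of the
Erdős–Tarski theorem (`HasIndepFamily.sum`). So `C` has a maximal independent family `a`, indexed by
`I` say, with `K` generated by `#I` elements. Each `S ⊆ I` yields an idempotent `e S` of `End Q`, and
`e S ∘ e T = e (S ∩ T)`. Take more than `#I` subsets of size `#I` that intersect pairwise in fewer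
than `#I` elements, and let `N` be generated by the `a i` and the elements `e S x`, where `x`
generates `C`. As no `e {i}` kills `x`, no `e S x` lies in the span of the `a i` and finitely many
of the others, so `N` is not generated by `#I` elements (`exists_not_generated`). But its preimage
in `ℕ →₀ C` has an essential submodule generated by `#I` elements, namely the preimage of the span
of the `a i`; hence it is itself generated by `#I` elements, a contradiction.

Therefore all cyclic, and so all finitely generated, submodules of `P` are noetherian. If an
endomorphism `φ` of `P` with finitely generated image fixes a finitely generated submodule `F`, then
`ker (1 - φ)` is a noetherian direct summand containing `F`. So a countably generated `P` is the
union of a chain of noetherian summands, and the general case reduces to this one by Kaplansky's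
theorem on projective modules.
-/

open Cardinal

/-! ### Hereditary modules and essential submodules -/

/-- Every nonzero element of `L` has a nonzero multiple in `N`. When `N ≤ L` this says that `N` is
essential in `L`; the inclusion is not part of the definition. -/
def EssentialIn {R : Type*} [Ring R] {M : Type*} [AddCommGroup M] [Module R M]
    (N L : Submodule R M) : Prop :=
  ∀ x ∈ L, x ≠ 0 → ∃ r : R, r • x ∈ N ∧ r • x ≠ 0

section Hereditary

variable {R : Type*} [Ring R] {M : Type*} [AddCommGroup M] [Module R M]

theorem IsHereditaryModule.projective_of_injective {M' : Type*} [AddCommGroup M'] [Module R M']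
    (hM : IsHereditaryModule R M) (f : M' →ₗ[R] M) (hf : Function.Injective f) :
    Module.Projective R M' :=
  have := hM (LinearMap.range f)
  Module.Projective.of_equiv (LinearEquiv.ofInjective f hf).symm

theorem IsHereditaryModule.of_injective {M' : Type*} [AddCommGroup M'] [Module R M']
    (hM : IsHereditaryModule R M) (f : M' →ₗ[R] M) (hf : Function.Injective f) :
    IsHereditaryModule R M' := fun N =>
  hM.projective_of_injective (f ∘ₗ N.subtype) (hf.comp N.injective_subtype)

theorem IsHereditaryModule.projective_of_le {C N : Submodule R M}
    (hC : IsHereditaryModule R C) (h : N ≤ C) : Module.Projective R N :=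
  hC.projective_of_injective (Submodule.inclusion h) (Submodule.inclusion_injective h)

/-- The kernel of a map with projective image is a direct summand, so it cannot be a proper
essential submodule. -/
theorem eq_zero_of_essentialIn_ker {M' : Type*} [AddCommGroup M'] [Module R M']
    (g : M →ₗ[R] M') [Module.Projective R (LinearMap.range g)]
    (hg : EssentialIn (LinearMap.ker g) ⊤) : g = 0 := by
  obtain ⟨s, hs⟩ := Module.projective_lifting_property g.rangeRestrict LinearMap.id
    g.surjective_rangeRestrict
  have hs' : ∀ y, g (s y) = y := fun y => congrArg Subtype.val (LinearMap.congr_fun hs y)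
  ext x
  set y := g.rangeRestrict x with hy
  by_contra hx
  have hy0 : s y ≠ 0 := by
    intro h
    apply hx
    have := hs' y
    rw [h, map_zero] at this
    exact this.symm
  obtain ⟨r, hr, hr0⟩ := hg (s y) trivial hy0
  apply hr0
  rw [LinearMap.mem_ker, ← map_smul, hs'] at hr
  rw [← map_smul]
  have : r • y = 0 := Subtype.ext hr
  rw [this, map_zero]

/-- Truncation of a dual basis `σ` to an index set `t`: the resulting endomorphism fixes the
elements whose coordinates are supported in `t`. -/
theorem exists_endomorphism_of_section {σ : M →ₗ[R] (M →₀ R)}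
    (hσ : ∀ y, Finsupp.linearCombination R id (σ y) = y) (t : Set M) :
    ∃ φ : M →ₗ[R] M, (∀ y, σ y ∈ Finsupp.supported R R t → φ y = y) ∧
      ∀ y, φ y ∈ Submodule.span R t := by
  classical
  let ρ : (M →₀ R) →ₗ[R] (M →₀ R) :=
    (Finsupp.supported R R t).subtype ∘ₗ Finsupp.restrictDom R R t
  refine ⟨Finsupp.linearCombination R id ∘ₗ ρ ∘ₗ σ, fun y hy => ?_, fun y => ?_⟩
  · have hρ : ρ (σ y) = σ y := by
      simp only [ρ, LinearMap.comp_apply, Submodule.subtype_apply, Finsupp.restrictDom_apply]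
      exact Finsupp.filter_eq_self_iff _ _ |>.2 fun x hx => hy (Finsupp.mem_support_iff.2 hx)
    simp only [LinearMap.comp_apply]
    rw [hρ, hσ]
  · have hρ : ρ (σ y) ∈ Finsupp.supported R R t := SetLike.coe_mem _
    have h2 := (Finsupp.mem_span_image_iff_linearCombination R (v := id) (s := t)
      (x := Finsupp.linearCombination R id (ρ (σ y)))).2 ⟨_, hρ, rfl⟩
    simpa using h2

/-- In a projective module, the identity on the submodule spanned by `s` is induced by an
endomorphism whose range is contained in a submodule with about as many generators as `s`. -/
theorem Module.Projective.exists_endomorphism_eq_id_on_span [Module.Projective R M] (s : Set M) :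
    ∃ (φ : M →ₗ[R] M) (t : Set M), (∀ y ∈ Submodule.span R s, φ y = y) ∧
      (∀ y, φ y ∈ Submodule.span R t) ∧ #t ≤ max #s ℵ₀ ∧ (s.Finite → t.Finite) := by
  classical
  obtain ⟨σ, hσ⟩ := (Module.projective_def' (R := R) (P := M)).1 inferInstance
  set t : Set M := ⋃ y ∈ s, ((σ y).support : Set M) with ht
  obtain ⟨φ, hφ, hran⟩ := exists_endomorphism_of_section (fun y => LinearMap.congr_fun hσ y) t
  refine ⟨φ, t, fun y hy => hφ y ?_, hran, ?_, ?_⟩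
  · have hle : Submodule.span R s ≤ (Finsupp.supported R R t).comap σ := by
      rw [Submodule.span_le]
      intro z hz
      simp only [Submodule.comap_coe, Set.mem_preimage, SetLike.mem_coe,
        Finsupp.mem_supported]
      exact Set.subset_biUnion_of_mem (u := fun y => ((σ y).support : Set M)) hz
    exact hle hy
  · refine (Cardinal.mk_biUnion_le _ _).trans ?_
    refine (mul_le_mul_right (ciSup_le' (a := ℵ₀) fun x => ?_) _).trans ?_
    · exact (Set.Countable.le_aleph0 (Finset.countable_toSet _))
    · exact (Cardinal.mul_le_max _ _).trans (by simp)
  · intro hs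
    exact hs.biUnion fun y _ => Finset.finite_toSet _

/-- In a hereditary module, a submodule needs essentially no more generators than any of its
essential submodules. -/
theorem IsHereditaryModule.exists_span_eq (hM : IsHereditaryModule R M) {N : Submodule R M}
    {s : Set M} (hs : s ⊆ N) (hess : EssentialIn (Submodule.span R s) N) :
    ∃ t : Set M, Submodule.span R t = N ∧ #t ≤ max #s ℵ₀ ∧ (s.Finite → t.Finite) := by
  have := hM N
  obtain ⟨φ, t, hφ, hran, hcard, hfin⟩ :=
    Module.Projective.exists_endomorphism_eq_id_on_span (R := R) (N.subtype ⁻¹' s : Set N)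
  have hspan : Submodule.map N.subtype (Submodule.span R (N.subtype ⁻¹' s)) =
      Submodule.span R s := by
    rw [Submodule.map_span, Set.image_preimage_eq_inter_range]
    congr 1
    rw [Submodule.coe_subtype, Subtype.range_coe]
    exact Set.inter_eq_left.2 hs
  have hzero : LinearMap.id - φ = 0 := by
    have : Module.Projective R (LinearMap.range (LinearMap.id - φ)) :=
      hM.projective_of_injective (N.subtype ∘ₗ Submodule.subtype _)
        (N.injective_subtype.comp (Submodule.injective_subtype _))
    apply eq_zero_of_essentialIn_ker
    intro x _ hx
    obtain ⟨r, hr, hr0⟩ := hess x x.2 (by simpa using hx)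
    refine ⟨r, ?_, fun h => hr0 (by rw [← Submodule.coe_smul, h, Submodule.coe_zero])⟩
    rw [← hspan] at hr
    obtain ⟨z, hz, hzr⟩ := hr
    have : z = r • x := Subtype.ext hzr
    rw [LinearMap.mem_ker, LinearMap.sub_apply, ← this, hφ z hz, LinearMap.id_apply, sub_self]
  have hid : ∀ x, φ x = x := fun x => (sub_eq_zero.1 (LinearMap.congr_fun hzero x)).symm
  refine ⟨N.subtype '' t, ?_, ?_, ?_⟩
  · rw [← Submodule.map_span]
    have : Submodule.span R t = ⊤ := by
      rw [eq_top_iff]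
      intro x _
      exact hid x ▸ hran x
    rw [this, Submodule.map_top, Submodule.range_subtype]
  · refine mk_image_le.trans (hcard.trans (max_le_max ?_ le_rfl))
    exact mk_preimage_of_injective _ _ N.injective_subtype
  · intro h
    exact (hfin (h.preimage N.injective_subtype.injOn)).image _

/-- Kaplansky's argument on submodules of direct sums: a submodule of `ℕ →₀ M` is isomorphic to
the direct sum of its submodules of leading coefficients. -/
theorem IsHereditaryModule.finsupp_nat (hM : IsHereditaryModule R M) :
    IsHereditaryModule R (ℕ →₀ M) := by
  classical
  intro N
  let V : ℕ → Submodule R (ℕ →₀ M) := fun n => N ⊓ Finsupp.supported M R (Set.Iio n)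
  have hV : ∀ n f, f ∈ V n ↔ f ∈ N ∧ ∀ k, n ≤ k → f k = 0 := by
    intro n f
    simp only [V, Submodule.mem_inf, Finsupp.mem_supported']
    simp
  let I : ℕ → Submodule R M := fun n => (V (n + 1)).map (Finsupp.lapply n)
  have hsec : ∀ n, ∃ s : I n →ₗ[R] N, ∀ y, (s y : ℕ →₀ M) n = y ∧
      ∀ k, n + 1 ≤ k → (s y : ℕ →₀ M) k = 0 := by
    intro n
    have := hM (I n)
    let p : V (n + 1) →ₗ[R] I n :=
      ((Finsupp.lapply n).domRestrict (V (n + 1))).codRestrict (I n) fun x => ⟨x, x.2, rfl⟩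
    have hp : Function.Surjective p := by
      rintro ⟨_, x, hx, rfl⟩
      exact ⟨⟨x, hx⟩, rfl⟩
    obtain ⟨s, hs⟩ := Module.projective_lifting_property p LinearMap.id hp
    refine ⟨Submodule.inclusion inf_le_left ∘ₗ s, fun y => ⟨?_, ?_⟩⟩
    · exact congrArg Subtype.val (LinearMap.congr_fun hs y)
    · exact ((hV _ _).1 (s y).2).2
  choose s hs1 using hsec
  have hs2 := fun n y => (hs1 n y).2
  replace hs1 := fun n y => (hs1 n y).1
  have : ∀ n, Module.Projective R (I n) := fun n => hM (I n)
  let Φ : (Π₀ n, I n) →ₗ[R] N := DFinsupp.lsum ℕ s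
  have hinj : Function.Injective Φ := by
    rw [← LinearMap.ker_eq_bot, LinearMap.ker_eq_bot']
    intro x hx
    by_contra hx0
    have hne : x.support.Nonempty := by
      rw [Finset.nonempty_iff_ne_empty]
      simpa using hx0
    set n := x.support.max' hne with hn
    have hmem : n ∈ x.support := x.support.max'_mem hne
    have h1 : ((Φ x : N) : ℕ →₀ M) n = x n := by
      have : Φ x = ∑ k ∈ x.support, s k (x k) := by
        simp only [Φ, DFinsupp.lsum_apply_apply, DFinsupp.sumAddHom_apply, DFinsupp.sum]
        rfl
      rw [this, Submodule.coe_sum, Finsupp.finsetSum_apply, Finset.sum_eq_single n]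
      · exact hs1 n _
      · intro k hk hkn
        exact hs2 k _ n (lt_of_le_of_ne (x.support.le_max' k hk) hkn)
      · exact fun h => absurd hmem h
    rw [hx] at h1
    exact (DFinsupp.mem_support_iff.1 hmem) (Subtype.ext h1.symm)
  have hsurj : Function.Surjective Φ := by
    have key : ∀ n, ∀ f : N, (∀ k, n ≤ k → (f : ℕ →₀ M) k = 0) → f ∈ LinearMap.range Φ := by
      intro n
      induction n with
      | zero =>
        intro f hf
        have : f = 0 := Subtype.ext (Finsupp.ext fun k => hf k (Nat.zero_le k))
        rw [this]
        exact zero_mem _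
      | succ n ih =>
        intro f hf
        have hy : (f : ℕ →₀ M) n ∈ I n := ⟨f, (hV _ _).2 ⟨f.2, hf⟩, rfl⟩
        have h1 : s n ⟨_, hy⟩ ∈ LinearMap.range Φ :=
          ⟨DFinsupp.single n ⟨_, hy⟩, by simp [Φ]⟩
        have h2 : f - s n ⟨_, hy⟩ ∈ LinearMap.range Φ := by
          apply ih
          intro k hk
          rw [Submodule.coe_sub, Finsupp.sub_apply]
          rcases hk.eq_or_lt with rfl | hk
          · rw [hs1, sub_self]
          · rw [hf k hk, hs2 n _ k hk, sub_self]
        simpa using add_mem h2 h1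
    intro f
    refine key ((f : ℕ →₀ M).support.sup id + 1) f fun k hk => ?_
    by_contra h
    have := Finset.le_sup (f := id) (Finsupp.mem_support_iff.2 h)
    simp only [id] at this
    omega
  exact Module.Projective.of_equiv (LinearEquiv.ofBijective Φ ⟨hinj, hsurj⟩)

end Hereditary

/-! ### Independent families of elements -/

/-- A family of nonzero elements whose cyclic submodules form a direct sum. -/
def IsIndepFamily (R : Type*) [Ring R] {M ι : Type*} [AddCommGroup M] [Module R M]
    (a : ι → M) : Prop :=
  (∀ i, a i ≠ 0) ∧ ∀ (s : Finset ι) (c : ι → R), ∑ i ∈ s, c i • a i = 0 → ∀ i ∈ s, c i • a i = 0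

/-- The submodule `X` contains a direct sum of at least `κ` nonzero cyclic modules. -/
def HasIndepFamily {R : Type*} [Ring R] {M : Type w} [AddCommGroup M] [Module R M]
    (X : Submodule R M) (κ : Cardinal.{w}) : Prop :=
  ∃ (ι : Type w) (a : ι → M), IsIndepFamily R a ∧ (∀ i, a i ∈ X) ∧ κ ≤ #ι

section IndepFamily

variable {R : Type*} [Ring R] {M : Type w} [AddCommGroup M] [Module R M]

theorem IsIndepFamily.comp {ι ι' : Type*} {a : ι → M} (ha : IsIndepFamily R a) {f : ι' → ι}
    (hf : Function.Injective f) : IsIndepFamily R (a ∘ f) := by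
  classical
  refine ⟨fun i => ha.1 _, fun s c h i hi => ?_⟩
  have key := ha.2 (s.map ⟨f, hf⟩) (Function.extend f c 0)
  simp only [Finset.sum_map, Function.Embedding.coeFn_mk, hf.extend_apply] at key
  have := key h (f i) (Finset.mem_map_of_mem ⟨f, hf⟩ hi)
  rwa [hf.extend_apply] at this

theorem IsIndepFamily.injective {ι : Type*} {a : ι → M} (ha : IsIndepFamily R a) :
    Function.Injective a := by
  classical
  intro i j hij
  by_contra hne
  have := ha.2 {i, j} (fun k => if k = i then 1 else -1)
    (by rw [Finset.sum_pair hne]; simp [Ne.symm hne, hij]) i (by simp)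
  simp only [if_true, one_smul] at this
  exact ha.1 i this

theorem IsIndepFamily.eq_zero_of_linearCombination {ι : Type*} {a : ι → M}
    (ha : IsIndepFamily R a) {c : ι →₀ R} (h : Finsupp.linearCombination R a c = 0) (i : ι) :
    c i • a i = 0 := by
  rw [Finsupp.linearCombination_apply, Finsupp.sum] at h
  by_cases hi : i ∈ c.support
  · exact ha.2 _ c h i hi
  · rw [Finsupp.notMem_support_iff.1 hi, zero_smul]

theorem IsIndepFamily.smul {ι : Type*} {a : ι → M} (ha : IsIndepFamily R a) (r : ι → R)
    (hr : ∀ i, r i • a i ≠ 0) : IsIndepFamily R (fun i => r i • a i) := by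
  refine ⟨hr, fun s c h i hi => ?_⟩
  have := ha.2 s (fun i => c i * r i) (by simpa only [mul_smul] using h) i hi
  simpa only [mul_smul] using this

/-- An injective map preserves independence. It suffices that it is injective on the span. -/
theorem IsIndepFamily.map {M' : Type*} [AddCommGroup M'] [Module R M'] {ι : Type*} {a : ι → M}
    (ha : IsIndepFamily R a) (p : M →ₗ[R] M')
    (hp : ∀ x ∈ Submodule.span R (Set.range a), p x = 0 → x = 0) :
    IsIndepFamily R (fun i => p (a i)) := by
  have hmem : ∀ i, a i ∈ Submodule.span R (Set.range a) := fun i => Submodule.subset_span ⟨i, rfl⟩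
  refine ⟨fun i h => ha.1 i (hp _ (hmem i) h), fun s c h i hi => ?_⟩
  rw [← map_smul, ha.2 s c (hp _ (Submodule.sum_mem _ fun j _ => Submodule.smul_mem _ _ (hmem j))
    (by simpa using h)) i hi, map_zero]

theorem IsIndepFamily.disjoint_span {ι : Type*} {a : ι → M} (ha : IsIndepFamily R a)
    {S T : Set ι} (h : Disjoint S T) :
    Disjoint (Submodule.span R (a '' S)) (Submodule.span R (a '' T)) := by
  classical
  rw [Submodule.disjoint_def]
  intro x hS hT
  obtain ⟨c, hc, rfl⟩ := (Finsupp.mem_span_image_iff_linearCombination R).1 hS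
  obtain ⟨d, hd, hcd⟩ := (Finsupp.mem_span_image_iff_linearCombination R).1 hT
  have h0 : Finsupp.linearCombination R a (c - d) = 0 := by rw [map_sub, hcd, sub_self]
  rw [Finsupp.linearCombination_apply, Finsupp.sum]
  refine Finset.sum_eq_zero fun i hi => ?_
  have h1 := ha.eq_zero_of_linearCombination h0 i
  have hiT : i ∉ T := Set.disjoint_left.1 h (hc hi)
  have : d i = 0 := by
    by_contra hne
    exact hiT (hd (Finsupp.mem_support_iff.2 hne))
  simpa [this] using h1

theorem eq_zero_of_disjoint_span_ker {ι : Type*} {a : ι → M} {M' : Type*} [AddCommGroup M']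
    [Module R M'] (p : M →ₗ[R] M') {J : Set ι}
    (h : Disjoint (Submodule.span R (a '' J)) (LinearMap.ker p)) :
    ∀ x ∈ Submodule.span R (Set.range fun j : J => a j), p x = 0 → x = 0 := by
  intro x hx hp
  rw [← Set.image_eq_range] at hx
  exact (Submodule.disjoint_def.1 h) x hx hp

theorem HasIndepFamily.mono {X Y : Submodule R M} {κ κ' : Cardinal.{w}}
    (h : HasIndepFamily X κ) (hXY : X ≤ Y) (hκ : κ' ≤ κ) : HasIndepFamily Y κ' := by
  obtain ⟨ι, a, ha, haX, hc⟩ := h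
  exact ⟨ι, a, ha, fun i => hXY (haX i), hκ.trans hc⟩

/-- Every independent family extends to one with essential span. -/
theorem HasIndepFamily.exists_maximal {X : Submodule R M} {κ : Cardinal.{w}}
    (h : HasIndepFamily X κ) : ∃ (ι : Type w) (a : ι → M), IsIndepFamily R a ∧ (∀ i, a i ∈ X) ∧
      κ ≤ #ι ∧ EssentialIn (Submodule.span R (Set.range a)) X := by
  classical
  obtain ⟨ι, a, ha, haX, hc⟩ := h
  let 𝒮 : Set (Set M) := {t | t ⊆ X ∧ (∀ m ∈ t, m ≠ 0) ∧ ∀ (s : Finset M) (c : M → R),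
    (s : Set M) ⊆ t → ∑ m ∈ s, c m • m = 0 → ∀ m ∈ s, c m • m = 0}
  have hrange : Set.range a ∈ 𝒮 := by
    refine ⟨by rintro _ ⟨i, rfl⟩; exact haX i, by rintro _ ⟨i, rfl⟩; exact ha.1 i, ?_⟩
    intro s c hs h m hm
    obtain ⟨i, rfl⟩ := hs hm
    refine ha.2 (s.preimage a ha.injective.injOn) (c ∘ a) ?_ i (by simpa using hm)
    rw [← h, ← Finset.sum_preimage a s ha.injective.injOn (fun m => c m • m)]
    · rfl
    · intro x hx hx'
      exact absurd (hs hx) hx'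
  obtain ⟨t, hat, ht⟩ := zorn_subset_nonempty 𝒮 (by
    intro C hC hchain hne
    refine ⟨⋃₀ C, ⟨Set.sUnion_subset fun t ht => (hC ht).1, ?_, ?_⟩,
      fun t ht => Set.subset_sUnion_of_mem ht⟩
    · rintro m ⟨t, ht, hm⟩
      exact (hC ht).2.1 m hm
    · intro s c hs
      obtain ⟨t, ht, hst⟩ := DirectedOn.exists_mem_subset_of_finset_subset_biUnion
        (f := id) hne hchain.directedOn (s := s) (by simpa [Set.sUnion_eq_biUnion] using hs)
      exact (hC ht).2.2 s c hst) _ hrange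
  have htI : IsIndepFamily R (Subtype.val : t → M) := by
    refine ⟨fun i => ht.prop.2.1 i i.2, fun s c h i hi => ?_⟩
    have := ht.prop.2.2 (s.map ⟨Subtype.val, Subtype.val_injective⟩)
      (Function.extend Subtype.val c 0) (by intro m; simp; tauto)
    simp only [Finset.sum_map, Function.Embedding.coeFn_mk,
      Subtype.val_injective.extend_apply] at this
    have := this h i (Finset.mem_map_of_mem _ hi)
    rwa [Subtype.val_injective.extend_apply] at this
  refine ⟨t, Subtype.val, htI, fun i => ht.prop.1 i.2, ?_, ?_⟩
  · refine hc.trans ?_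
    rw [← mk_range_eq a ha.injective]
    exact mk_le_mk_of_subset hat
  · rw [Subtype.range_coe]
    intro x hx hx0
    by_contra! hno
    -- no multiple of `x` meets the span of `t`, so `x` could be added to `t`
    have hxt : x ∉ t := fun h => by
      have := hno 1 (by rw [one_smul]; exact Submodule.subset_span h)
      rw [one_smul] at this
      exact hx0 this
    have hins : insert x t ∈ 𝒮 := by
      refine ⟨Set.insert_subset hx ht.prop.1, ?_, ?_⟩
      · rintro m (rfl | hm)
        · exact hx0
        · exact ht.prop.2.1 m hm
      · intro s c hs h
        have hsub : ((s.erase x : Finset M) : Set M) ⊆ t := by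
          intro m hm
          simp only [Finset.coe_erase, Set.mem_sdiff, Set.mem_singleton_iff] at hm
          exact (hs hm.1).resolve_left hm.2
        by_cases hxs : x ∈ s
        · rw [← Finset.add_sum_erase _ _ hxs] at h
          have h1 : c x • x = 0 := by
            apply hno
            rw [eq_neg_of_add_eq_zero_left h]
            exact Submodule.neg_mem _ (Submodule.sum_mem _ fun m hm =>
              Submodule.smul_mem _ _ (Submodule.subset_span (hsub hm)))
          rw [h1, zero_add] at h
          intro m hm
          by_cases hmx : m = x
          · rw [hmx, h1]
          · exact ht.prop.2.2 _ c hsub h m (Finset.mem_erase.2 ⟨hmx, hm⟩)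
        · rw [Finset.erase_eq_of_notMem hxs] at hsub
          exact ht.prop.2.2 _ c hsub h
    exact hxt (ht.le_of_ge hins (Set.subset_insert x t) (Set.mem_insert x t))

/-- Exchange: the index set splits into a part whose span avoids `X`, and a part
which can be moved into `X`. -/
theorem IsIndepFamily.exchange {ι : Type*} {a : ι → M} (ha : IsIndepFamily R a)
    (X : Submodule R M) : ∃ (J : Set ι) (b : (Jᶜ : Set ι) → M),
      Disjoint (Submodule.span R (a '' J)) X ∧ IsIndepFamily R b ∧ (∀ i, b i ∈ X) ∧
      ∀ i, b i ∈ Submodule.span R (Set.range a) := by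
  classical
  obtain ⟨J, hJ⟩ := zorn_subset {J : Set ι | Disjoint (Submodule.span R (a '' J)) X} (by
    intro C hC hchain
    rcases C.eq_empty_or_nonempty with rfl | hne
    · exact ⟨∅, by simp, by simp⟩
    refine ⟨⋃₀ C, ?_, fun t ht => Set.subset_sUnion_of_mem ht⟩
    simp only [Set.mem_ofPred_eq, Submodule.disjoint_def]
    intro x hx hxX
    obtain ⟨c, hc, rfl⟩ := (Finsupp.mem_span_image_iff_linearCombination R).1 hx
    obtain ⟨t, ht, hst⟩ := DirectedOn.exists_mem_subset_of_finset_subset_biUnion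
        (f := id) hne hchain.directedOn (s := c.support)
        (by simpa [Set.sUnion_eq_biUnion, Finsupp.mem_supported] using hc)
    exact (Submodule.disjoint_def.1 (hC ht)) _
      ((Finsupp.mem_span_image_iff_linearCombination R).2 ⟨c, hst, rfl⟩) hxX)
  have hex : ∀ i : (Jᶜ : Set ι), ∃ u ∈ Submodule.span R (a '' J), ∃ r : R,
      u + r • a i ∈ X ∧ u + r • a i ≠ 0 := by
    intro i
    by_contra! hno
    have : insert (i : ι) J ∈ {J : Set ι | Disjoint (Submodule.span R (a '' J)) X} := by
      simp only [Set.mem_ofPred_eq, Submodule.disjoint_def, Set.image_insert_eq]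
      intro x hx hxX
      obtain ⟨r, u, hu, rfl⟩ := Submodule.mem_span_insert.1 hx
      rw [add_comm] at hxX ⊢
      exact hno u hu r hxX
    exact i.2 (hJ.le_of_ge this (Set.subset_insert _ J) (Set.mem_insert _ J))
  choose u hu r hX h0 using hex
  refine ⟨J, fun i => u i + r i • a i, hJ.prop, ⟨h0, fun s c h => ?_⟩, hX, fun i => ?_⟩
  · have hdis : Disjoint (Submodule.span R (a '' J)) (Submodule.span R (a '' Jᶜ)) :=
      ha.disjoint_span disjoint_compl_right
    simp only [smul_add, Finset.sum_add_distrib] at h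
    have h1 : ∑ i ∈ s, c i • r i • a i = 0 := by
      apply (Submodule.disjoint_def.1 hdis)
      · rw [eq_neg_of_add_eq_zero_right h]
        exact Submodule.neg_mem _ (Submodule.sum_mem _ fun i _ =>
          Submodule.smul_mem _ _ (hu i))
      · exact Submodule.sum_mem _ fun i _ => Submodule.smul_mem _ _ (Submodule.smul_mem _ _
          (Submodule.subset_span ⟨i, i.2, rfl⟩))
    intro i hi
    have h2 : c i • r i • a i = 0 := by
      have := (ha.comp (Subtype.val_injective (p := (· ∈ Jᶜ)))).2 s (fun i => c i * r i)
        (by simp only [mul_smul]; exact h1) i hi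
      simp only [mul_smul] at this
      exact this
    apply (Submodule.disjoint_def.1 hJ.prop)
    · rw [smul_add, h2, add_zero]
      exact Submodule.smul_mem _ _ (hu i)
    · exact Submodule.smul_mem _ _ (hX i)
  · exact Submodule.add_mem _ (Submodule.span_mono (Set.image_subset_range _ _) (hu i))
      (Submodule.smul_mem _ _ (Submodule.subset_span ⟨i, rfl⟩))

theorem exists_large_subset {ι : Type w} {κ : Cardinal.{w}} (hκ : ℵ₀ ≤ κ) (h : κ ≤ #ι)
    (J : Set ι) : κ ≤ #J ∨ κ ≤ #(Jᶜ : Set ι) := by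
  by_contra! hlt
  exact absurd (h.trans_eq (mk_sum_compl J).symm) (add_lt_of_lt hκ hlt.1 hlt.2).not_ge

theorem HasIndepFamily.ker_or_map {M' : Type w} [AddCommGroup M'] [Module R M'] {X : Submodule R M}
    {κ : Cardinal.{w}} (hκ : ℵ₀ ≤ κ) (h : HasIndepFamily X κ) (p : M →ₗ[R] M') :
    HasIndepFamily (X ⊓ LinearMap.ker p) κ ∨ HasIndepFamily (X.map p) κ := by
  obtain ⟨ι, a, ha, haX, hc⟩ := h
  obtain ⟨J, b, hJ, hb, hbX, hba⟩ := ha.exchange (LinearMap.ker p)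
  have hspan : Submodule.span R (Set.range a) ≤ X := Submodule.span_le.2 (by
    rintro _ ⟨i, rfl⟩; exact haX i)
  rcases exists_large_subset hκ hc J with h | h
  · exact Or.inr ⟨J, _, (ha.comp Subtype.val_injective).map p
      (eq_zero_of_disjoint_span_ker p hJ), fun i => ⟨_, haX i, rfl⟩, h⟩
  · exact Or.inl ⟨_, b, hb, fun i => ⟨hspan (hba i), hbX i⟩, h⟩

theorem HasIndepFamily.left_or_right {X X₁ X₂ : Submodule R M} {κ : Cardinal.{w}} (hκ : ℵ₀ ≤ κ)
    (h : HasIndepFamily X κ) (hdis : Disjoint X₁ X₂) (hess : EssentialIn (X₁ ⊔ X₂) X) :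
    HasIndepFamily X₁ κ ∨ HasIndepFamily X₂ κ := by
  obtain ⟨ι, a, ha, haX, hc⟩ := h
  choose r hr hr0 using fun i => hess (a i) (haX i) (ha.1 i)
  replace ha := ha.smul r hr0
  obtain ⟨J, b, hJ, hb, hbX, -⟩ := ha.exchange X₁
  rcases exists_large_subset hκ hc J with h | h
  · right
    choose y hy z hz hyz using fun i => Submodule.mem_sup.1 (hr i)
    have key : ∀ (s : Finset J) (c : J → R), ∑ i ∈ s, c i • z i = 0 →
        ∑ i ∈ s, c i • r i • a i = 0 := by
      intro s c h
      apply (Submodule.disjoint_def.1 hJ)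
      · exact Submodule.sum_mem _ fun i _ => Submodule.smul_mem _ _
          (Submodule.subset_span ⟨i, i.2, rfl⟩)
      · simp only [← hyz, smul_add, Finset.sum_add_distrib, h, add_zero]
        exact Submodule.sum_mem _ fun i _ => Submodule.smul_mem _ _ (hy i)
    refine ⟨J, fun i => z i, ⟨fun i h0 => ?_, fun s c h i hi => ?_⟩, fun i => hz i, h⟩
    · have := key {i} 1 (by simpa using h0)
      exact hr0 i (by simpa using this)
    · have h1 := (ha.comp (Subtype.val_injective (p := (· ∈ J)))).2 s c (key s c h) i hi
      simp only [Function.comp_apply, ← hyz, smul_add] at h1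
      apply (Submodule.disjoint_def.1 hdis)
      · rw [eq_neg_of_add_eq_zero_right h1]
        exact Submodule.neg_mem _ (Submodule.smul_mem _ _ (hy i))
      · exact Submodule.smul_mem _ _ (hz i)
  · exact Or.inl ⟨_, b, hb, hbX, h⟩

theorem IsIndepFamily.sigma {ι : Type*} {β : ι → Type*} {B : ι → Submodule R M}
    (hB : iSupIndep B) {a : ∀ i, β i → M} (ha : ∀ i, IsIndepFamily R (a i))
    (haB : ∀ i j, a i j ∈ B i) : IsIndepFamily R (fun x : Σ i, β i => a x.1 x.2) := by
  classical
  refine ⟨fun x => (ha _).1 _, fun s c h => ?_⟩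
  rw [← Finset.sigma_image_fst_preimage_mk s, Finset.sum_sigma] at h
  have h1 := (iSupIndep_iff_finsetSum_eq_zero_imp_eq_zero B).1 hB _ _ (fun i _ =>
    Submodule.sum_mem _ fun j _ => Submodule.smul_mem _ _ (haB i j)) h
  rintro ⟨i, j⟩ hij
  exact (ha i).2 _ _ (h1 i (Finset.mem_image_of_mem Sigma.fst hij)) j (by simpa using hij)

end IndepFamily

/-! ### Suprema of sizes of independent families -/

section Attained

variable {R : Type*} [Ring R] {M : Type w} [AddCommGroup M] [Module R M]

/-- If `B n` lies in the `n`-th term of a decreasing sequence and is disjoint from the next term,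
then the `B n` are independent: look at the smallest index in a relation. -/
theorem iSupIndep_of_antitone {B X : ℕ → Submodule R M} (hX : Antitone X) (hB : ∀ n, B n ≤ X n)
    (hdis : ∀ n, Disjoint (B n) (X (n + 1))) : iSupIndep B := by
  classical
  rw [iSupIndep_iff_finsetSum_eq_zero_imp_eq_zero]
  intro s v hv h
  by_contra! hne
  obtain ⟨i, hi, hi0⟩ := hne
  have hne : (s.filter (v · ≠ 0)).Nonempty := ⟨i, Finset.mem_filter.2 ⟨hi, hi0⟩⟩
  set n := (s.filter (v · ≠ 0)).min' hne with hn
  obtain ⟨hns, hn0⟩ := Finset.mem_filter.1 ((s.filter (v · ≠ 0)).min'_mem hne)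
  rw [← hn] at hns hn0
  apply hn0
  apply (Submodule.disjoint_def.1 (hdis n)) _ (hv n hns)
  rw [← Finset.add_sum_erase _ _ hns] at h
  rw [eq_neg_of_add_eq_zero_left h]
  refine Submodule.neg_mem _ (Submodule.sum_mem _ fun m hm => ?_)
  by_cases hm0 : v m = 0
  · rw [hm0]
    exact zero_mem _
  · have hms := Finset.mem_of_mem_erase hm
    have hle := (s.filter (v · ≠ 0)).min'_le m (Finset.mem_filter.2 ⟨hms, hm0⟩)
    have hlt : n < m := lt_of_le_of_ne hle (Finset.ne_of_mem_erase hm).symm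
    exact hX hlt (hB m (hv m hms))

/-- One step of the splitting: a maximal independent family is halved, and one of the halves
still contains independent families of all the sizes `μ m`. -/
theorem HasIndepFamily.exists_split {μ : ℕ → Cardinal.{w}} (hμ : Monotone μ)
    (hinf : ∀ n, ℵ₀ ≤ μ n) {X : Submodule R M} (h : ∀ n, HasIndepFamily X (μ n)) (n : ℕ) :
    ∃ B X' : Submodule R M, B ≤ X ∧ X' ≤ X ∧ Disjoint B X' ∧ HasIndepFamily B (μ n) ∧
      ∀ m, HasIndepFamily X' (μ m) := by
  obtain ⟨ι, a, ha, haX, hc, hess⟩ := (h n).exists_maximal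
  have : Infinite ι := infinite_iff.2 ((hinf n).trans hc)
  obtain ⟨e⟩ : Nonempty (ι ⊕ ι ≃ ι) := by
    rw [← Cardinal.eq, mk_sum, lift_id, add_eq_self ((hinf n).trans hc)]
  set S : Set ι := Set.range (e ∘ Sum.inl) with hS
  set T : Set ι := Set.range (e ∘ Sum.inr) with hT
  have hST : Disjoint S T := by
    rw [Set.disjoint_left]
    rintro _ ⟨i, rfl⟩ ⟨j, hj⟩
    exact Sum.inr_ne_inl (e.injective hj)
  have hle : ∀ S : Set ι, Submodule.span R (a '' S) ≤ X := fun S => Submodule.span_le.2 (by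
    rintro _ ⟨i, -, rfl⟩; exact haX i)
  have hXS : HasIndepFamily (Submodule.span R (a '' S)) (μ n) :=
    ⟨ι, _, ha.comp (e.injective.comp Sum.inl_injective),
      fun i => Submodule.subset_span ⟨_, ⟨i, rfl⟩, rfl⟩, hc⟩
  have hXT : HasIndepFamily (Submodule.span R (a '' T)) (μ n) :=
    ⟨ι, _, ha.comp (e.injective.comp Sum.inr_injective),
      fun i => Submodule.subset_span ⟨_, ⟨i, rfl⟩, rfl⟩, hc⟩
  have hess' : EssentialIn (Submodule.span R (a '' S) ⊔ Submodule.span R (a '' T)) X := by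
    rw [← Submodule.span_union, ← Set.image_union]
    have : S ∪ T = Set.univ := by
      rw [Set.eq_univ_iff_forall]
      intro i
      obtain ⟨j, rfl⟩ := e.surjective i
      rcases j with j | j
      · exact Or.inl ⟨j, rfl⟩
      · exact Or.inr ⟨j, rfl⟩
    rwa [this, Set.image_univ]
  by_cases hbig : ∀ m, HasIndepFamily (Submodule.span R (a '' S)) (μ m)
  · exact ⟨_, _, hle T, hle S, (ha.disjoint_span hST).symm, hXT, hbig⟩
  · push Not at hbig
    obtain ⟨k, hk⟩ := hbig
    refine ⟨_, _, hle S, hle T, ha.disjoint_span hST, hXS, fun m => ?_⟩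
    rcases (h (max m k)).left_or_right (hinf _) (ha.disjoint_span hST) hess' with h' | h'
    · exact absurd (h'.mono le_rfl (hμ (le_max_right m k))) hk
    · exact h'.mono le_rfl (hμ (le_max_left m k))

/-- A module form of the Erdős–Tarski theorem: the supremum of countably many sizes of independent
families is again attained. -/
theorem HasIndepFamily.sum {μ : ℕ → Cardinal.{w}} (hμ : Monotone μ)
    (hinf : ∀ n, ℵ₀ ≤ μ n) {X : Submodule R M} (h : ∀ n, HasIndepFamily X (μ n)) :
    HasIndepFamily X (Cardinal.sum μ) := by
  choose B X' hB hX' hdis hBn hbig using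
    fun (n : ℕ) (Y : {Y : Submodule R M // ∀ m, HasIndepFamily Y (μ m)}) =>
      HasIndepFamily.exists_split hμ hinf Y.2 n
  let Y : ℕ → {Y : Submodule R M // ∀ m, HasIndepFamily Y (μ m)} :=
    fun n => Nat.rec ⟨X, h⟩ (fun n Y => ⟨X' n Y, hbig n Y⟩) n
  have hanti : Antitone fun n => (Y n).1 := antitone_nat_of_succ_le (f := fun n => (Y n).1)
    fun n => hX' n (Y n)
  have hind : iSupIndep fun n => B n (Y n) :=
    iSupIndep_of_antitone hanti (fun n => hB n (Y n)) fun n => hdis n (Y n)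
  choose ι a ha haB hc using fun n => hBn n (Y n)
  refine ⟨Σ n, ι n, _, IsIndepFamily.sigma hind ha haB, fun x => ?_, ?_⟩
  · exact hanti (Nat.zero_le _) (hB _ _ (haB x.1 x.2))
  · rw [mk_sigma]
    exact sum_le_sum _ _ hc

/-- An infinite independent family in `ℕ →₀ M` is no larger than some independent family
in `M`. -/
theorem HasIndepFamily.of_finsupp_nat {κ : Cardinal.{w}}
    (h : HasIndepFamily (⊤ : Submodule R (ℕ →₀ M)) κ)
    (hM : HasIndepFamily (⊤ : Submodule R M) ℵ₀) : HasIndepFamily (⊤ : Submodule R M) κ := by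
  classical
  have key : ∀ n : ℕ, ∀ κ : Cardinal.{w}, ℵ₀ ≤ κ →
      HasIndepFamily (Finsupp.supported M R (Set.Iio n)) κ →
      HasIndepFamily (⊤ : Submodule R M) κ := by
    intro n
    induction n with
    | zero =>
      rintro κ hκ ⟨ι, a, ha, haX, hc⟩
      have hne : #ι ≠ 0 := (aleph0_pos.trans_le (hκ.trans hc)).ne'
      obtain ⟨i⟩ := mk_ne_zero_iff.1 hne
      exact absurd (by simpa using haX i) (ha.1 i)
    | succ n ih =>
      intro κ hκ h
      rcases h.ker_or_map hκ (Finsupp.lapply n) with h | h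
      · refine ih κ hκ (h.mono ?_ le_rfl)
        rintro f ⟨hf, hfn⟩
        rw [SetLike.mem_coe, Finsupp.mem_supported'] at hf
        rw [Finsupp.mem_supported']
        intro k hk
        simp only [Set.mem_Iio, not_lt] at hk
        rcases hk.eq_or_lt with rfl | hk
        · exact hfn
        · exact hf k (by simpa using hk)
      · exact h.mono le_top le_rfl
  obtain ⟨ι, a, ha, -, hc⟩ := h
  let S : ℕ → Set ι := fun n => {i | a i ∈ Finsupp.supported M R (Set.Iio n)}
  have hmono : Monotone S := fun m n hmn i hi =>
    Finsupp.supported_mono (M := M) (R := R) (Set.Iio_subset_Iio hmn) hi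
  have hunion : ⋃ n, S n = Set.univ := by
    rw [Set.eq_univ_iff_forall]
    intro i
    refine Set.mem_iUnion.2 ⟨(a i).support.sup id + 1, ?_⟩
    simp only [S, Set.mem_ofPred_eq, Finsupp.mem_supported]
    intro k hk
    exact Nat.lt_succ_of_le (Finset.le_sup (f := id) hk)
  have hall : ∀ n, HasIndepFamily (⊤ : Submodule R M) (max #(S n) ℵ₀) := by
    intro n
    rcases le_total #(S n) ℵ₀ with h | h
    · rwa [max_eq_right h]
    · rw [max_eq_left h]
      exact key n _ h ⟨S n, _, ha.comp Subtype.val_injective, fun i => i.2, le_rfl⟩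
  refine (HasIndepFamily.sum (μ := fun n => max #(S n) ℵ₀)
    (fun m n hmn => max_le_max (mk_le_mk_of_subset (hmono hmn)) le_rfl)
    (fun n => le_max_right _ _) hall).mono le_rfl (hc.trans ?_)
  rw [← mk_univ, ← hunion, ← lift_uzero #(⋃ n, S n)]
  refine (mk_iUnion_le_sum_mk_lift (f := S)).trans ?_
  refine sum_le_sum _ _ fun n => le_max_left _ _

end Attained

/-! ### Almost disjoint families -/

/-- For every infinite `I` there are more than `#I` functions `I → I` any two of which agree on
fewer than `#I` arguments. A maximal such family cannot be enumerated by `I`, by diagonalization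
along a well-order of minimal type. -/
theorem exists_almost_different_functions (I : Type w) [Infinite I] :
    ∃ 𝓕 : Set (I → I), #I < #𝓕 ∧ ∀ f ∈ 𝓕, ∀ g ∈ 𝓕, f ≠ g → #{i | f i = g i} < #I := by
  obtain ⟨𝓕, h𝓕⟩ := zorn_subset
    {𝓕 : Set (I → I) | ∀ f ∈ 𝓕, ∀ g ∈ 𝓕, f ≠ g → #{i | f i = g i} < #I} (by
      intro C hC hchain
      refine ⟨⋃₀ C, ?_, fun t ht => Set.subset_sUnion_of_mem ht⟩
      rintro f ⟨s, hs, hf⟩ g ⟨t, ht, hg⟩ hne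
      rcases hchain.total hs ht with h | h
      · exact hC ht f (h hf) g hg hne
      · exact hC hs f hf g (h hg) hne)
  refine ⟨𝓕, ?_, h𝓕.prop⟩
  by_contra! hle
  rcases 𝓕.eq_empty_or_nonempty with hempty | hne
  · have h1 : ({id} : Set (I → I)) ∈
        {𝓕 : Set (I → I) | ∀ f ∈ 𝓕, ∀ g ∈ 𝓕, f ≠ g → #{i | f i = g i} < #I} := by
      rintro f rfl g rfl h
      exact absurd rfl h
    have := h𝓕.le_of_ge h1 (by rw [hempty]; exact Set.empty_subset _) rfl
    rw [hempty] at this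
    exact this
  have : Nonempty 𝓕 := hne.to_subtype
  obtain ⟨G, hG⟩ : ∃ G : I → 𝓕, Function.Surjective G := by
    obtain ⟨j⟩ := (Cardinal.le_def _ _).1 hle
    exact ⟨Function.invFun j, Function.invFun_surjective j.injective⟩
  obtain ⟨r, hr, hord⟩ := Cardinal.exists_ord_eq I
  have hsmall : ∀ i, #{j | r j i} < #I := fun i => card_typein_lt i hord
  have hdiag : ∀ i, ∃ k, k ∉ (fun j => (G j : I → I) i) '' {j | r j i} := by
    intro i
    by_contra! hall
    have : (fun j => (G j : I → I) i) '' {j | r j i} = Set.univ :=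
      Set.eq_univ_of_forall hall
    have h2 := mk_image_le (f := fun j => (G j : I → I) i) (s := {j | r j i})
    rw [this, mk_univ] at h2
    exact absurd (hsmall i) h2.not_gt
  choose f hf using hdiag
  -- `f` agrees with `G j` only at indices that do not exceed `j`
  have hagree : ∀ g ∈ 𝓕, #{i | f i = g i} < #I := by
    intro g hg
    obtain ⟨j, hj⟩ := hG ⟨g, hg⟩
    have hsub : {i | f i = g i} ⊆ insert j {i | r i j} := by
      intro i hi
      rcases trichotomous_of r i j with h | h | h
      · exact Or.inr h
      · exact Or.inl h
      · exact absurd ⟨j, h, by simp only [hj]; exact Eq.symm hi⟩ (hf i)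
    refine (mk_le_mk_of_subset hsub).trans_lt (mk_insert_le.trans_lt ?_)
    exact add_lt_of_lt (aleph0_le_mk I) (hsmall j) (one_lt_aleph0.trans_le (aleph0_le_mk I))
  have hfF : f ∈ 𝓕 := by
    have hins : insert f 𝓕 ∈
        {𝓕 : Set (I → I) | ∀ f ∈ 𝓕, ∀ g ∈ 𝓕, f ≠ g → #{i | f i = g i} < #I} := by
      rintro g (rfl | hg) g' (rfl | hg') hne
      · exact absurd rfl hne
      · exact hagree g' hg'
      · simpa only [eq_comm] using hagree g hg
      · exact h𝓕.prop g hg g' hg' hne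
    exact h𝓕.le_of_ge hins (Set.subset_insert f 𝓕) (Set.mem_insert f 𝓕)
  have := hagree f hfF
  simp at this

theorem mk_biUnion_finset_lt {α β : Type w} {κ : Cardinal.{w}} (hκ : ℵ₀ ≤ κ) (s : Finset β)
    (A : β → Set α) (h : ∀ i ∈ s, #(A i) < κ) : #(⋃ i ∈ s, A i) < κ := by
  classical
  induction s using Finset.induction_on with
  | empty => simpa using aleph0_pos.trans_le hκ
  | insert b s hb ih =>
    rw [Finset.set_biUnion_insert]
    refine (mk_union_le _ _).trans_lt (add_lt_of_lt hκ (h b (by simp)) (ih fun i hi => ?_))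
    exact h i (Finset.mem_insert_of_mem hi)

/-! ### Quasi-injective modules -/

section QuasiInjective

variable {R : Type u} [Ring R] {Q : Type w} [AddCommGroup Q] [Module R Q]

theorem EssentialIn.comap {M : Type*} [AddCommGroup M] [Module R M] {N : Submodule R Q}
    (h : EssentialIn N ⊤) (f : M →ₗ[R] Q) : EssentialIn (N.comap f) ⊤ := by
  intro x _ hx
  by_cases hfx : f x = 0
  · exact ⟨1, by simp [hfx], by simpa using hx⟩
  · obtain ⟨r, hr, hr0⟩ := h (f x) trivial hfx
    refine ⟨r, by simpa using hr, fun h0 => hr0 ?_⟩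
    rw [← map_smul, h0, map_zero]

theorem EssentialIn.trans {A B C : Submodule R Q} (h₁ : EssentialIn A B) (h₂ : EssentialIn B C) :
    EssentialIn A C := by
  intro x hx hx0
  obtain ⟨r, hr, hr0⟩ := h₂ x hx hx0
  obtain ⟨s, hs, hs0⟩ := h₁ _ hr hr0
  exact ⟨s * r, by rwa [mul_smul], by rwa [mul_smul]⟩

theorem IsQuasiInjectiveModule.exists_comp_eq (hQ : IsQuasiInjectiveModule R Q) {X : Type*}
    [AddCommGroup X] [Module R X] (f g : X →ₗ[R] Q)
    (h : LinearMap.ker f ≤ LinearMap.ker g) : ∃ e : Q →ₗ[R] Q, ∀ x, e (f x) = g x := by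
  obtain ⟨e, he⟩ := hQ (LinearMap.range f)
    ((LinearMap.ker f).liftQ g h ∘ₗ f.quotKerEquivRange.symm.toLinearMap)
  refine ⟨e, fun x => ?_⟩
  have := he ⟨f x, x, rfl⟩
  rw [this]
  simp only [LinearMap.comp_apply, LinearEquiv.coe_coe]
  have h2 : f.quotKerEquivRange.symm ⟨f x, x, rfl⟩ = (LinearMap.ker f).mkQ x := by
    rw [LinearEquiv.symm_apply_eq]
    rfl
  rw [h2]
  simp

/-- The trace of `C` in a quasi-injective module is fully invariant, hence quasi-injective; so it is
everything if the module is minimal over `C`. -/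
theorem IsQuasiInjectiveModule.iSup_map_eq_top (hQ : IsQuasiInjectiveModule R Q)
    {C : Submodule R Q} (hmin : ∀ N : Submodule R Q, C ≤ N → IsQuasiInjectiveModule R N → N = ⊤) :
    ⨆ g : Q →ₗ[R] Q, C.map g = ⊤ := by
  apply hmin
  · exact (le_of_eq (Submodule.map_id C).symm).trans
      (le_iSup (fun g : Q →ₗ[R] Q => C.map g) LinearMap.id)
  · set N := ⨆ g : Q →ₗ[R] Q, C.map g with hN
    intro K f
    obtain ⟨e, he⟩ := hQ.exists_comp_eq (N.subtype ∘ₗ K.subtype) (N.subtype ∘ₗ f) (by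
      intro x hx
      have : x = 0 := by simpa using hx
      rw [this]
      exact zero_mem _)
    have hinv : ∀ y ∈ N, e y ∈ N := by
      have : N ≤ N.comap e := by
        nth_rewrite 1 [hN]
        rw [iSup_le_iff]
        intro g
        rw [← Submodule.map_le_iff_le_comap, ← Submodule.map_comp]
        exact le_iSup (fun g : Q →ₗ[R] Q => C.map g) (e ∘ₗ g)
      exact this
    exact ⟨e.restrict hinv, fun x => Subtype.ext (he x)⟩

/-- If `Q` is generated by the images of an essential hereditary submodule, then `Q` is
nonsingular over its endomorphism ring: no nonzero endomorphism has an essential kernel. -/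
theorem endomorphism_eq_zero_of_essentialIn_ker {C : Submodule R Q} (hC : IsHereditaryModule R C)
    (hess : EssentialIn C ⊤) (hgen : ⨆ g : Q →ₗ[R] Q, C.map g = ⊤) (h : Q →ₗ[R] Q)
    (hker : EssentialIn (LinearMap.ker h) ⊤) : h = 0 := by
  have key : ∀ f : Q →ₗ[R] Q, EssentialIn (LinearMap.ker f) ⊤ → ∀ c ∈ C, f c = 0 := by
    intro f hf
    have hzero : ∀ c ∈ C, f c ∈ C → f c = 0 := by
      intro c hc hfc
      let L : Submodule R Q := C ⊓ C.comap f
      have hran : LinearMap.range (f.domRestrict L) ≤ C := by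
        rintro _ ⟨y, rfl⟩
        exact y.2.2
      have := hC.projective_of_le hran
      have h0 := eq_zero_of_essentialIn_ker (f.domRestrict L) (by
        intro y _ hy
        obtain ⟨r, hr, hr0⟩ := hf y trivial (by simpa using hy)
        exact ⟨r, by simpa using hr, fun h0 => hr0 (by rw [← Submodule.coe_smul, h0]; rfl)⟩)
      exact LinearMap.congr_fun h0 ⟨c, hc, hfc⟩
    intro c hc
    by_contra hne
    obtain ⟨r, hr, hr0⟩ := hess (f c) trivial hne
    rw [← map_smul] at hr hr0
    exact hr0 (hzero _ (C.smul_mem r hc) hr)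
  rw [← LinearMap.ker_eq_top, eq_top_iff, ← hgen, iSup_le_iff]
  rintro g _ ⟨c, hc, rfl⟩
  refine key (h ∘ₗ g) ?_ c hc
  rw [LinearMap.ker_comp]
  exact hker.comap g

/-- The coordinate projections attached to an independent family in a quasi-injective module. -/
theorem IsQuasiInjectiveModule.exists_projections (hQ : IsQuasiInjectiveModule R Q) {I : Type*}
    {a : I → Q} (ha : IsIndepFamily R a) : ∃ e : Set I → Q →ₗ[R] Q,
      ∀ S i, (i ∈ S → e S (a i) = a i) ∧ (i ∉ S → e S (a i) = 0) := by
  classical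
  have : ∀ S : Set I, ∃ e : Q →ₗ[R] Q, ∀ i, e (a i) = if i ∈ S then a i else 0 := by
    intro S
    obtain ⟨e, he⟩ := hQ.exists_comp_eq (Finsupp.linearCombination R a)
      (Finsupp.linearCombination R fun i => if i ∈ S then a i else 0) (by
        intro c hc
        rw [LinearMap.mem_ker, Finsupp.linearCombination_apply, Finsupp.sum]
        refine Finset.sum_eq_zero fun i _ => ?_
        split_ifs
        · exact ha.eq_zero_of_linearCombination hc i
        · exact smul_zero _)
    refine ⟨e, fun i => ?_⟩
    simpa using he (Finsupp.single i 1)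
  choose e he using this
  exact ⟨e, fun S i => ⟨fun h => by rw [he, if_pos h], fun h => by rw [he, if_neg h]⟩⟩

theorem eqOn_of_eqOn_essential {C : Submodule R Q} (hC : IsHereditaryModule R C)
    (hess : EssentialIn C ⊤) (hgen : ⨆ g : Q →ₗ[R] Q, C.map g = ⊤) {I : Type*} {a : I → Q}
    (ha : EssentialIn (Submodule.span R (Set.range a)) ⊤) {f g : Q →ₗ[R] Q}
    (h : ∀ i, f (a i) = g (a i)) : f = g := by
  rw [← sub_eq_zero]
  apply endomorphism_eq_zero_of_essentialIn_ker hC hess hgen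
  intro x hx hx0
  obtain ⟨r, hr, hr0⟩ := ha x hx hx0
  refine ⟨r, ?_, hr0⟩
  have hle : Submodule.span R (Set.range a) ≤ LinearMap.ker (f - g) := by
    rw [Submodule.span_le]
    rintro _ ⟨i, rfl⟩
    simp [h i]
  exact hle hr

theorem exists_finset_of_mem_span_image {M α : Type*} [AddCommGroup M] [Module R M] {f : α → M}
    {S : Set α} {x : M} (hx : x ∈ Submodule.span R (f '' S)) :
    ∃ T : Finset α, (T : Set α) ⊆ S ∧ x ∈ Submodule.span R (f '' T) := by
  obtain ⟨c, hc, rfl⟩ := (Finsupp.mem_span_image_iff_linearCombination R).1 hx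
  exact ⟨c.support, hc, (Finsupp.mem_span_image_iff_linearCombination R).2
    ⟨c, fun _ h => h, rfl⟩⟩

end QuasiInjective

/-! ### Cyclic hereditary modules with countably generated quasi-injective hull -/

section Cyclic

variable {R : Type u} [Ring R] {Q : Type w} [AddCommGroup Q] [Module R Q]

theorem exists_seq_iSup_map_eq_top {C : Submodule R Q} (hQ : IsCountablyGeneratedModule R Q)
    (hgen : ⨆ g : Q →ₗ[R] Q, C.map g = ⊤) :
    ∃ g : ℕ → Q →ₗ[R] Q, ⨆ n, C.map (g n) = ⊤ := by
  obtain ⟨s, hs, hspan⟩ := hQ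
  have hfin : ∀ q : Q, ∃ T : Finset (Q →ₗ[R] Q), q ∈ ⨆ g ∈ T, C.map g := fun q =>
    Submodule.mem_iSup_iff_exists_finset.1 (hgen ▸ Submodule.mem_top)
  choose T hT using hfin
  have hcount : (insert 0 (⋃ q ∈ s, (T q : Set (Q →ₗ[R] Q)))).Countable :=
    (hs.biUnion fun q _ => (T q).countable_toSet).insert 0
  obtain ⟨g, hg⟩ := hcount.exists_eq_range (Set.insert_nonempty _ _)
  refine ⟨g, ?_⟩
  rw [eq_top_iff, ← hspan, Submodule.span_le]
  intro q hq
  have hle : ⨆ g ∈ T q, C.map g ≤ ⨆ n, C.map (g n) := by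
    refine iSup₂_le fun f hf => ?_
    have : f ∈ Set.range g := by
      rw [← hg]
      exact Set.mem_insert_of_mem _ (Set.mem_biUnion hq hf)
    obtain ⟨n, rfl⟩ := this
    exact le_iSup (fun n => C.map (g n)) n
  exact hle (hT q)

/-- Many almost disjoint projections, applied to a generator of a cyclic essential submodule, force
`Q` to have a submodule with a `#I`-generated essential submodule that is not itself
`#I`-generated. -/
theorem exists_not_generated (hQ : IsQuasiInjectiveModule R Q) {x : Q}
    (hC : IsHereditaryModule R (Submodule.span R {x}))
    (hess : EssentialIn (Submodule.span R {x}) ⊤)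
    (hgen : ⨆ g : Q →ₗ[R] Q, (Submodule.span R {x}).map g = ⊤) {I : Type w} [Infinite I]
    {a : I → Q} (ha : IsIndepFamily R a) (haC : ∀ i, a i ∈ Submodule.span R {x})
    (haess : EssentialIn (Submodule.span R (Set.range a)) ⊤) :
    ∃ N : Submodule R Q, Submodule.span R (Set.range a) ≤ N ∧
      ∀ Y : Set Q, Submodule.span R Y = N → ¬ #Y ≤ #I := by
  classical
  obtain ⟨e, he⟩ := hQ.exists_projections ha
  have hmul : ∀ S T, e S ∘ₗ e T = e (S ∩ T) := by
    intro S T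
    apply eqOn_of_eqOn_essential hC hess hgen haess
    intro i
    rw [LinearMap.comp_apply]
    by_cases hT : i ∈ T
    · rw [(he T i).1 hT]
      by_cases hS : i ∈ S
      · rw [(he S i).1 hS, (he (S ∩ T) i).1 ⟨hS, hT⟩]
      · rw [(he S i).2 hS, (he (S ∩ T) i).2 fun h => hS h.1]
    · rw [(he T i).2 hT, map_zero, (he (S ∩ T) i).2 fun h => hT h.2]
  -- the projections onto single coordinates do not kill the generator
  have hx0 : ∀ i, e {i} x ≠ 0 := by
    intro i h
    obtain ⟨r, hr⟩ := Submodule.mem_span_singleton.1 (haC i)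
    apply ha.1 i
    rw [← (he {i} i).1 rfl, ← hr, map_smul, h, smul_zero]
  have hempty : e ∅ = 0 := by
    apply eqOn_of_eqOn_essential hC hess hgen haess
    intro i
    rw [(he ∅ i).2 (Set.notMem_empty i), LinearMap.zero_apply]
  obtain ⟨𝓕, hcard, halm⟩ := exists_almost_different_functions I
  obtain ⟨ε⟩ : Nonempty (I ≃ I × I) := by
    rw [← Cardinal.eq, mk_prod, lift_id, mul_eq_self (aleph0_le_mk I)]
  let G : (I → I) → Set I := fun f => {i | (ε i).2 = f (ε i).1}
  let y : (I → I) → Q := fun f => e (G f) x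
  refine ⟨Submodule.span R (Set.range a) ⊔ Submodule.span R (y '' 𝓕), le_sup_left, ?_⟩
  intro Y hY hYI
  -- `Y` involves only `#I` of the functions
  have hmem : ∀ z ∈ Y, ∃ Φ : Finset (I → I), (Φ : Set (I → I)) ⊆ 𝓕 ∧
      z ∈ Submodule.span R (Set.range a) ⊔ Submodule.span R (y '' Φ) := by
    intro z hz
    have hz' := Submodule.subset_span (R := R) hz
    rw [hY] at hz'
    obtain ⟨u, hu, v, hv, rfl⟩ := Submodule.mem_sup.1 hz'
    obtain ⟨Φ, hΦ, hvΦ⟩ := exists_finset_of_mem_span_image hv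
    exact ⟨Φ, hΦ, Submodule.add_mem_sup hu hvΦ⟩
  choose! Φ hΦ hzΦ using hmem
  have hΘ : #(⋃ z ∈ Y, (Φ z : Set (I → I))) ≤ #I := by
    refine (mk_biUnion_le _ _).trans ((mul_le_mul' hYI (ciSup_le' (a := ℵ₀) fun z => ?_)).trans ?_)
    · exact (Finset.countable_toSet _).le_aleph0
    · rw [mul_aleph0_eq (aleph0_le_mk I)]
  obtain ⟨β, hβ, hβΘ⟩ : ∃ β ∈ 𝓕, β ∉ ⋃ z ∈ Y, (Φ z : Set (I → I)) := by
    by_contra! h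
    exact absurd ((mk_le_mk_of_subset h).trans hΘ) hcard.not_ge
  have hyβ : y β ∈ Submodule.span R (Set.range a) ⊔
      Submodule.span R (y '' ⋃ z ∈ Y, (Φ z : Set (I → I))) := by
    have hle : Submodule.span R Y ≤ Submodule.span R (Set.range a) ⊔
        Submodule.span R (y '' ⋃ z ∈ Y, (Φ z : Set (I → I))) := by
      rw [Submodule.span_le]
      intro z hz
      have hsub : (Φ z : Set (I → I)) ⊆ ⋃ z ∈ Y, (Φ z : Set (I → I)) :=
        Set.subset_biUnion_of_mem (u := fun z => (Φ z : Set (I → I))) hz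
      have hmono := sup_le_sup (le_refl (Submodule.span R (Set.range a)))
        (Submodule.span_mono (R := R) (Set.image_mono (f := y) hsub))
      exact hmono (hzΦ z hz)
    apply hle
    rw [hY]
    exact le_sup_right (a := Submodule.span R (Set.range a))
      (Submodule.subset_span ⟨β, hβ, rfl⟩)
  obtain ⟨u, hu, v, hv, huv⟩ := Submodule.mem_sup.1 hyβ
  rw [← Set.image_univ] at hu
  obtain ⟨T, -, hu⟩ := exists_finset_of_mem_span_image hu
  obtain ⟨Ψ, hΨ, hv⟩ := exists_finset_of_mem_span_image hv
  -- `y β` is fixed by the projection belonging to `U`, but `G β` is not contained in `U`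
  set U : Set I := (T : Set I) ∪ ⋃ f ∈ Ψ, G f with hU
  have hfixu : e U u = u := by
    have hle : Submodule.span R (a '' T) ≤ LinearMap.eqLocus (e U) LinearMap.id := by
      rw [Submodule.span_le]
      rintro _ ⟨i, hi, rfl⟩
      exact (he U i).1 (Or.inl hi)
    exact hle hu
  have hfixv : e U v = v := by
    have hle : Submodule.span R (y '' Ψ) ≤ LinearMap.eqLocus (e U) LinearMap.id := by
      rw [Submodule.span_le]
      rintro _ ⟨f, hf, rfl⟩
      have hsub : G f ⊆ U := fun i hi => Or.inr (Set.mem_biUnion hf hi)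
      change e U (e (G f) x) = e (G f) x
      rw [← LinearMap.comp_apply, hmul, Set.inter_eq_right.2 hsub]
    exact hle hv
  have hfix : e U (y β) = y β := by rw [← huv, map_add, hfixu, hfixv]
  obtain ⟨ν, hν⟩ : ∃ ν, ν ∉ (⋃ f ∈ Ψ, {i | β i = f i}) ∪ ((fun i => (ε i).1) '' (T : Set I)) := by
    by_contra! h
    have h1 : #((⋃ f ∈ Ψ, {i | β i = f i}) ∪ ((fun i => (ε i).1) '' (T : Set I)) : Set I) < #I := by
      refine (mk_union_le _ _).trans_lt (add_lt_of_lt (aleph0_le_mk I) ?_ ?_)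
      · refine mk_biUnion_finset_lt (aleph0_le_mk I) Ψ _ fun f hf => ?_
        have hfΘ := hΨ hf
        refine halm β hβ f ?_ ?_
        · obtain ⟨z, hz, hfz⟩ := Set.mem_iUnion₂.1 hfΘ
          exact hΦ z hz hfz
        · rintro rfl
          exact hβΘ hfΘ
      · exact ((T.finite_toSet.image _).lt_aleph0).trans_le (aleph0_le_mk I)
    rw [Set.eq_univ_of_forall h, mk_univ] at h1
    exact lt_irrefl _ h1
  set i := ε.symm (ν, β ν) with hi
  have hiG : i ∈ G β := by simp [G, hi]
  have hiU : i ∉ U := by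
    rintro (h | h)
    · exact hν (Or.inr ⟨i, h, by simp [hi]⟩)
    · obtain ⟨f, hf, hif⟩ := Set.mem_iUnion₂.1 h
      refine hν (Or.inl (Set.mem_biUnion hf ?_))
      simpa [G, hi] using hif
  apply hx0 i
  have h1 : e {i} (y β) = e {i} x := by
    change e {i} (e (G β) x) = _
    rw [← LinearMap.comp_apply, hmul, Set.inter_eq_left.2 (Set.singleton_subset_iff.2 hiG)]
  rw [← h1, ← hfix, ← LinearMap.comp_apply, hmul,
    Set.singleton_inter_eq_empty.2 hiU, hempty, LinearMap.zero_apply]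

/-- An infinite independent family in `C` would, after enlarging it to dominate the kernel of a
presentation of `Q` by copies of `C`, contradict the bound on generators in hereditary modules. -/
theorem not_hasIndepFamily_aleph0 (hQ : IsQuasiInjectiveModule R Q)
    (hcg : IsCountablyGeneratedModule R Q) {x : Q}
    (hC : IsHereditaryModule R (Submodule.span R {x}))
    (hess : EssentialIn (Submodule.span R {x}) ⊤)
    (hgen : ⨆ g : Q →ₗ[R] Q, (Submodule.span R {x}).map g = ⊤) :
    ¬ HasIndepFamily (⊤ : Submodule R (Submodule.span R {x})) ℵ₀ := by
  classical
  intro hinf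
  set C := Submodule.span R {x} with hCdef
  obtain ⟨g, hg⟩ := exists_seq_iSup_map_eq_top hcg hgen
  let π : (ℕ →₀ C) →ₗ[R] Q := Finsupp.lsum ℕ fun n => g n ∘ₗ C.subtype
  have hπ : Function.Surjective π := by
    rw [← LinearMap.range_eq_top, eq_top_iff, ← hg, iSup_le_iff]
    rintro n _ ⟨c, hc, rfl⟩
    exact ⟨Finsupp.single n ⟨c, hc⟩, by simp [π]⟩
  have hF : IsHereditaryModule R (ℕ →₀ C) := hC.finsupp_nat
  -- the kernel of the presentation has at most `κ` generators
  obtain ⟨ι, b, hb, hbK, -, hbess⟩ := HasIndepFamily.exists_maximal (X := LinearMap.ker π) (κ := 0)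
    ⟨PEmpty, PEmpty.elim, ⟨fun i => i.elim, fun s c _ i => i.elim⟩, fun i => i.elim, zero_le⟩
  obtain ⟨t, ht, htc, -⟩ := hF.exists_span_eq (s := Set.range b)
    (by rintro _ ⟨i, rfl⟩; exact hbK i) hbess
  rw [mk_range_eq _ hb.injective] at htc
  have hκ : HasIndepFamily (⊤ : Submodule R C) (max #ι ℵ₀) := by
    rcases le_total #ι ℵ₀ with h | h
    · rwa [max_eq_right h]
    · rw [max_eq_left h]
      exact HasIndepFamily.of_finsupp_nat ⟨ι, b, hb, fun _ => trivial, le_rfl⟩ hinf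
  have hκ' : HasIndepFamily C (max #ι ℵ₀) := by
    obtain ⟨ι', a, ha, -, hc⟩ := hκ
    exact ⟨ι', fun i => a i, ha.map C.subtype fun y _ hy => Subtype.ext hy, fun i => (a i).2, hc⟩
  obtain ⟨I, a, ha, haC, hcI, haess⟩ := hκ'.exists_maximal
  have hI : ℵ₀ ≤ #I := (le_max_right _ _).trans hcI
  have : Infinite I := infinite_iff.2 hI
  have haess' := haess.trans hess
  obtain ⟨N, haN, hN⟩ := exists_not_generated hQ hC hess hgen ha haC haess'
  choose b' hb' using fun i => hπ (a i)
  have hsub : t ∪ Set.range b' ⊆ N.comap π := by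
    rintro z (hz | ⟨i, rfl⟩)
    · have : z ∈ LinearMap.ker π := ht ▸ Submodule.subset_span hz
      rw [SetLike.mem_coe, Submodule.mem_comap, LinearMap.mem_ker.1 this]
      exact zero_mem N
    · rw [SetLike.mem_coe, Submodule.mem_comap, hb']
      exact haN (Submodule.subset_span ⟨i, rfl⟩)
  have hle : (Submodule.span R (Set.range a)).comap π ≤ Submodule.span R (t ∪ Set.range b') := by
    intro z hz
    have hmap : (Submodule.span R (Set.range b')).map π = Submodule.span R (Set.range a) := by
      rw [Submodule.map_span, ← Set.range_comp]
      congr 2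
      exact funext hb'
    rw [Submodule.mem_comap, ← hmap] at hz
    obtain ⟨z', hz', hzz⟩ := hz
    rw [Submodule.span_union, ht, ← sub_add_cancel z z']
    refine Submodule.add_mem_sup ?_ hz'
    rw [LinearMap.mem_ker, map_sub, hzz, sub_self]
  obtain ⟨Y, hY, hYc, -⟩ := hF.exists_span_eq hsub (fun z _ hz0 => by
    obtain ⟨r, hr, hr0⟩ := haess'.comap π z trivial hz0
    exact ⟨r, hle hr, hr0⟩)
  refine hN (π '' Y) ?_ ?_
  · rw [← Submodule.map_span, hY, Submodule.map_comap_eq_of_surjective hπ]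
  · refine mk_image_le.trans ?_
    refine hYc.trans (max_le ((mk_union_le _ _).trans (add_le_of_le hI ?_ mk_range_le)) hI)
    exact htc.trans hcI

/-- A hereditary module without infinite independent families is noetherian: each submodule has a
finitely generated essential submodule, hence is finitely generated. -/
theorem IsHereditaryModule.isNoetherian (hQ : IsHereditaryModule R Q)
    (h : ¬ HasIndepFamily (⊤ : Submodule R Q) ℵ₀) : IsNoetherian R Q := by
  refine ⟨fun N => ?_⟩
  obtain ⟨ι, b, hb, hbN, -, hbess⟩ := HasIndepFamily.exists_maximal (X := N) (κ := 0)
    ⟨PEmpty, PEmpty.elim, ⟨fun i => i.elim, fun s c _ i => i.elim⟩, fun i => i.elim, zero_le⟩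
  have : Finite ι := by
    by_contra hfin
    rw [not_finite_iff_infinite] at hfin
    exact h ⟨ι, b, hb, fun _ => trivial, aleph0_le_mk ι⟩
  obtain ⟨t, ht, -, hfin⟩ := hQ.exists_span_eq (s := Set.range b)
    (by rintro _ ⟨i, rfl⟩; exact hbN i) hbess
  exact Submodule.fg_def.2 ⟨t, hfin (Set.finite_range b), ht⟩

/-- A cyclic hereditary module with a countably generated quasi-injective hull is noetherian. -/
theorem isNoetherian_span_singleton_of_hull {P : Type v} [AddCommGroup P] [Module R P]
    (hP : IsHereditaryModule R P) (x : P) {i : Submodule.span R {x} →ₗ[R] Q}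
    (hi : IsQuasiInjectiveHull i) (hcg : IsCountablyGeneratedModule R Q) :
    IsNoetherian R (Submodule.span R {x}) := by
  set x' : Submodule.span R {x} := ⟨x, Submodule.mem_span_singleton_self x⟩ with hx'
  have hran : LinearMap.range i = Submodule.span R {i x'} := by
    apply le_antisymm
    · rintro _ ⟨⟨y, hy⟩, rfl⟩
      obtain ⟨r, rfl⟩ := Submodule.mem_span_singleton.1 hy
      exact Submodule.mem_span_singleton.2 ⟨r, by rw [← map_smul]; rfl⟩
    · rw [Submodule.span_singleton_le_iff_mem]
      exact ⟨x', rfl⟩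
  have hhull := hi.minimal
  have hess := hi.essential
  rw [hran] at hhull hess
  let ψ : Submodule.span R {x} ≃ₗ[R] Submodule.span R {i x'} :=
    (LinearEquiv.ofInjective i hi.injective).trans (LinearEquiv.ofEq _ _ hran)
  have hC : IsHereditaryModule R (Submodule.span R {i x'}) :=
    hP.of_injective ((Submodule.span R {x}).subtype ∘ₗ ψ.symm.toLinearMap)
      ((Submodule.injective_subtype _).comp ψ.symm.injective)
  have hess' : EssentialIn (Submodule.span R {i x'}) ⊤ := by
    intro y _ hy
    by_contra! hno
    apply hy
    rw [← Submodule.span_singleton_eq_bot (R := R)]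
    apply hess
    rw [eq_bot_iff]
    rintro z ⟨hz, hz'⟩
    obtain ⟨r, rfl⟩ := Submodule.mem_span_singleton.1 hz
    exact hno r hz'
  have := hC.isNoetherian (not_hasIndepFamily_aleph0 hi.quasiInjective hcg hC hess'
    (hi.quasiInjective.iSup_map_eq_top hhull))
  exact isNoetherian_of_linearEquiv ψ.symm

end Cyclic

/-! ### Decomposition of locally noetherian hereditary modules -/

section Decomposition

variable {R : Type u} [Ring R] {P : Type v} [AddCommGroup P] [Module R P]

/-- If `φ x` is the identity on `U x`, kills `D x`, and `U x` contains all earlier `D y`, then the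
`D x` are independent: apply `φ x` for the largest index `x` in a relation. -/
theorem iSupIndep_of_projections {ι : Type*} [LinearOrder ι] {D U : ι → Submodule R P}
    {φ : ι → P →ₗ[R] P} (hφ : ∀ x, ∀ y ∈ U x, φ x y = y) (hD : ∀ x, D x ≤ LinearMap.ker (φ x))
    (hlt : ∀ x y, y < x → D y ≤ U x) : iSupIndep D := by
  classical
  rw [iSupIndep_iff_finsetSum_eq_zero_imp_eq_zero]
  intro s v hv h
  by_contra! hne
  obtain ⟨i, hi, hi0⟩ := hne
  have hne : (s.filter (v · ≠ 0)).Nonempty := ⟨i, Finset.mem_filter.2 ⟨hi, hi0⟩⟩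
  set n := (s.filter (v · ≠ 0)).max' hne with hn
  obtain ⟨hns, hn0⟩ := Finset.mem_filter.1 ((s.filter (v · ≠ 0)).max'_mem hne)
  rw [← hn] at hns hn0
  rw [← Finset.add_sum_erase _ _ hns] at h
  have hmem : v n ∈ U n := by
    rw [eq_neg_of_add_eq_zero_left h]
    refine Submodule.neg_mem _ (Submodule.sum_mem _ fun m hm => ?_)
    by_cases hm0 : v m = 0
    · rw [hm0]
      exact zero_mem _
    · have hms := Finset.mem_of_mem_erase hm
      have hle := (s.filter (v · ≠ 0)).le_max' m (Finset.mem_filter.2 ⟨hms, hm0⟩)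
      exact hlt n m (lt_of_le_of_ne hle (Finset.ne_of_mem_erase hm)) (hv m hms)
  apply hn0
  rw [← hφ n _ hmem]
  exact hD n (hv n hns)

theorem iSupIndep_sigma {ι : Type*} {β : ι → Type*} {D : ι → Submodule R P} (hD : iSupIndep D)
    {N : ∀ i, β i → Submodule R P} (hN : ∀ i, iSupIndep (N i)) (hle : ∀ i j, N i j ≤ D i) :
    iSupIndep fun x : Σ i, β i => N x.1 x.2 := by
  classical
  rw [iSupIndep_iff_finsetSum_eq_zero_imp_eq_zero]
  intro s v hv h
  rw [← Finset.sigma_image_fst_preimage_mk s, Finset.sum_sigma] at h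
  have hvs : ∀ i, ∀ j ∈ s.preimage (Sigma.mk i) sigma_mk_injective.injOn, v ⟨i, j⟩ ∈ N i j :=
    fun i j hj => hv _ (by simpa using hj)
  have h1 := (iSupIndep_iff_finsetSum_eq_zero_imp_eq_zero D).1 hD _ _ (fun i _ =>
    Submodule.sum_mem _ fun j hj => hle i j (hvs i j hj)) h
  rintro ⟨i, j⟩ hij
  exact (iSupIndep_iff_finsetSum_eq_zero_imp_eq_zero (N i)).1 (hN i) _ (fun j => v ⟨i, j⟩)
    (hvs i) (h1 i (Finset.mem_image_of_mem Sigma.fst hij)) j (by simpa using hij)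

/-- In a hereditary module with noetherian finitely generated submodules, each such submodule lies
in a noetherian direct summand: the fixed submodule of a suitable endomorphism `φ`. -/
theorem IsHereditaryModule.exists_noetherian_summand (hP : IsHereditaryModule R P)
    (hnoeth : ∀ N : Submodule R P, N.FG → IsNoetherian R N) {F : Submodule R P} (hF : F.FG) :
    ∃ (W : Submodule R P) (ψ : P →ₗ[R] P), F ≤ W ∧ IsNoetherian R W ∧ (∀ y, ψ y ∈ W) ∧
      ∀ y ∈ W, ψ y = y := by
  have : Module.Projective R P := hP.projective_of_injective LinearMap.id Function.injective_id
  obtain ⟨s, hs, rfl⟩ := Submodule.fg_def.1 hF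
  obtain ⟨φ, t, hφ, hran, -, hfin⟩ :=
    Module.Projective.exists_endomorphism_eq_id_on_span (R := R) s
  have := hnoeth _ (Submodule.fg_span (R := R) (hfin hs))
  set δ : P →ₗ[R] P := LinearMap.id - φ with hδ
  have := hP (LinearMap.range δ)
  obtain ⟨σ, hσ⟩ := Module.projective_lifting_property δ.rangeRestrict LinearMap.id
    δ.surjective_rangeRestrict
  have hσ' : ∀ y, δ (σ y) = y := fun y => congrArg Subtype.val (LinearMap.congr_fun hσ y)
  refine ⟨LinearMap.ker δ, LinearMap.id - σ ∘ₗ δ.rangeRestrict, fun y hy => ?_,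
    isNoetherian_of_le (t := Submodule.span R t) fun y hy => ?_, fun y => ?_, fun y hy => ?_⟩
  · rw [LinearMap.mem_ker, hδ, LinearMap.sub_apply, hφ y hy, LinearMap.id_apply, sub_self]
  · have : y = φ y := sub_eq_zero.1 hy
    rw [this]
    exact hran y
  · change δ (y - σ (δ.rangeRestrict y)) = 0
    rw [map_sub, hσ']
    exact sub_self _
  · have : δ.rangeRestrict y = 0 := Subtype.ext hy
    rw [LinearMap.sub_apply, LinearMap.comp_apply, this, map_zero, sub_zero, LinearMap.id_apply]

theorem IsHereditaryModule.exists_decomposition_nat (hP : IsHereditaryModule R P)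
    (hnoeth : ∀ N : Submodule R P, N.FG → IsNoetherian R N)
    (hcg : IsCountablyGeneratedModule R P) :
    ∃ N : ℕ → Submodule R P, iSupIndep N ∧ iSup N = ⊤ ∧ ∀ n, IsNoetherian R (N n) := by
  obtain ⟨s, hs, hspan⟩ := hcg
  obtain ⟨d, hd⟩ := (hs.insert 0).exists_eq_range (Set.insert_nonempty _ _)
  let T := {p : Submodule R P × (P →ₗ[R] P) //
    IsNoetherian R p.1 ∧ (∀ y, p.2 y ∈ p.1) ∧ ∀ y ∈ p.1, p.2 y = y}
  have hstep : ∀ (n : ℕ) (p : T), ∃ q : T, p.1.1 ≤ q.1.1 ∧ d n ∈ q.1.1 := by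
    rintro n ⟨⟨W, ψ⟩, hW, -, -⟩
    obtain ⟨W', ψ', hle, h1, h2, h3⟩ := hP.exists_noetherian_summand hnoeth
      (Submodule.FG.sup (isNoetherian_submodule.1 hW W le_rfl)
        (Submodule.fg_span_singleton (R := R) (d n)))
    exact ⟨⟨⟨W', ψ'⟩, h1, h2, h3⟩, le_sup_left.trans hle,
      hle (Submodule.mem_sup_right (Submodule.mem_span_singleton_self _))⟩
  choose q hq1 hq2 using hstep
  let S : ℕ → T := fun n => Nat.rec ⟨⟨⊥, 0⟩, inferInstance, fun _ => rfl, fun y hy => by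
    simpa [eq_comm] using hy⟩ q n
  let W : ℕ → Submodule R P := fun n => (S n).1.1
  let ψ : ℕ → P →ₗ[R] P := fun n => (S n).1.2
  have hmono : Monotone W := monotone_nat_of_le_succ fun n => hq1 n (S n)
  have hψW : ∀ n y, ψ n y ∈ W n := fun n => (S n).2.2.1
  have hψ : ∀ n, ∀ y ∈ W n, ψ n y = y := fun n => (S n).2.2.2
  refine ⟨fun n => W (n + 1) ⊓ LinearMap.ker (ψ n), ?_, ?_, fun n => ?_⟩
  · exact iSupIndep_of_projections hψ (fun n => inf_le_right)
      fun n m hmn => inf_le_left.trans (hmono hmn)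
  · set E : ℕ → Submodule R P := fun n => W (n + 1) ⊓ LinearMap.ker (ψ n) with hE
    have hle : ∀ n, W n ≤ iSup E := by
      intro n
      induction n with
      | zero => exact bot_le
      | succ n ih =>
        intro z hz
        rw [← add_sub_cancel (ψ n z) z]
        refine add_mem (ih (hψW n z)) (le_iSup E n ⟨?_, ?_⟩)
        · exact sub_mem hz (hmono n.le_succ (hψW n z))
        · rw [SetLike.mem_coe, LinearMap.mem_ker, map_sub, hψ n _ (hψW n z), sub_self]
    rw [eq_top_iff, ← hspan, Submodule.span_le]
    intro z hz
    have : z ∈ Set.range d := hd ▸ Set.mem_insert_of_mem _ hz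
    obtain ⟨n, rfl⟩ := this
    exact hle (n + 1) (hq2 n (S n))
  · have : IsNoetherian R (W (n + 1)) := (S (n + 1)).2.1
    exact isNoetherian_of_le inf_le_left

/-- Kaplansky's theorem: a projective module is a direct sum of countably generated submodules.

With respect to a dual basis `σ`, call a set `t` closed if the elements of `t` have all their
coordinates in `t`; truncating `σ` to `t` then gives a projection onto the span of `t`. Every
element lies in a countable closed set, and for a well-order of the module, the summands are
complements of the spans of the closed sets generated by initial segments. -/
theorem Module.Projective.exists_countably_generated_decomposition [Module.Projective R P] :
    ∃ D : P → Submodule R P, iSupIndep D ∧ iSup D = ⊤ ∧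
      ∀ x, ∃ s : Set P, s.Countable ∧ Submodule.span R s = D x := by
  classical
  obtain ⟨σ, hσ⟩ := (Module.projective_def' (R := R) (P := P)).1 inferInstance
  have hσ' : ∀ y, Finsupp.linearCombination R id (σ y) = y := fun y => LinearMap.congr_fun hσ y
  have hcl : ∀ x, ∃ t : Set P, t.Countable ∧ x ∈ t ∧ ∀ y ∈ t, ((σ y).support : Set P) ⊆ t := by
    intro x
    let A : ℕ → Set P := fun n => Nat.rec {x} (fun _ t => ⋃ y ∈ t, ((σ y).support : Set P)) n
    refine ⟨⋃ n, A n, Set.countable_iUnion fun n => ?_, Set.mem_iUnion.2 ⟨0, rfl⟩, ?_⟩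
    · induction n with
      | zero => exact Set.countable_singleton x
      | succ n ih => exact ih.biUnion fun y _ => Finset.countable_toSet _
    · intro y hy
      obtain ⟨n, hn⟩ := Set.mem_iUnion.1 hy
      refine Set.Subset.trans ?_ (Set.subset_iUnion A (n + 1))
      exact Set.subset_biUnion_of_mem (u := fun y => ((σ y).support : Set P)) hn
  choose cl hcount hself hclosed using hcl
  obtain ⟨_, hwf⟩ := exists_wellFoundedLT P
  let X : P → Set P := fun x => ⋃ y ∈ Set.Iio x, cl y
  have hX : ∀ x, ∀ y ∈ Submodule.span R (X x), σ y ∈ Finsupp.supported R R (X x) := by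
    intro x
    have : Submodule.span R (X x) ≤ (Finsupp.supported R R (X x)).comap σ := by
      rw [Submodule.span_le]
      intro y hy
      obtain ⟨z, hz, hyz⟩ := Set.mem_iUnion₂.1 hy
      exact (hclosed z y hyz).trans (Set.subset_biUnion_of_mem (u := cl) hz)
    exact this
  choose φ hφ hran using fun x => exists_endomorphism_of_section hσ' (X x)
  have hφX : ∀ x, ∀ y ∈ Submodule.span R (X x), φ x y = y := fun x y hy => hφ x y (hX x y hy)
  have hclX : ∀ x y, y < x → cl y ⊆ X x := fun x y hyx =>
    Set.subset_biUnion_of_mem (u := cl) (show y ∈ Set.Iio x from hyx)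
  let D : P → Submodule R P := fun x => (Submodule.span R (cl x)).map (LinearMap.id - φ x)
  refine ⟨D, ?_, ?_, fun x => ⟨(LinearMap.id - φ x : P →ₗ[R] P) '' cl x, (hcount x).image _, ?_⟩⟩
  · refine iSupIndep_of_projections (φ := φ) (U := fun x => Submodule.span R (X x)) hφX ?_ ?_
    · rintro x _ ⟨y, -, rfl⟩
      rw [LinearMap.mem_ker, LinearMap.sub_apply, map_sub, LinearMap.id_apply,
        hφX x _ (hran x y), sub_self]
    · rintro x y hyx _ ⟨z, hz, rfl⟩
      refine sub_mem (Submodule.span_mono (hclX x y hyx) hz) (Submodule.span_mono ?_ (hran y z))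
      exact Set.iUnion₂_subset fun w hw => hclX x w (lt_trans hw hyx)
  · have hle : ∀ x, Submodule.span R (cl x) ≤ iSup D := by
      intro x
      induction x using hwf.induction with
      | _ x ih =>
        intro z hz
        rw [← add_sub_cancel (φ x z) z]
        refine add_mem ?_ (le_iSup D x ⟨z, hz, rfl⟩)
        have hXle : Submodule.span R (X x) ≤ iSup D := by
          rw [Submodule.span_le]
          exact Set.iUnion₂_subset fun y hy => (Submodule.subset_span (R := R)).trans (ih y hy)
        exact hXle (hran x z)
    rw [eq_top_iff]
    exact fun x _ => hle x (Submodule.subset_span (hself x))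
  · rw [← Submodule.map_span]

theorem IsHereditaryModule.exists_decomposition (hP : IsHereditaryModule R P)
    (hnoeth : ∀ N : Submodule R P, N.FG → IsNoetherian R N) :
    ∃ N : (Σ _ : P, ℕ) → Submodule R P, iSupIndep N ∧ iSup N = ⊤ ∧
      ∀ k, IsNoetherian R (N k) := by
  have : Module.Projective R P := hP.projective_of_injective LinearMap.id Function.injective_id
  obtain ⟨D, hD, htop, hcg⟩ :=
    Module.Projective.exists_countably_generated_decomposition (R := R) (P := P)
  have key : ∀ x, ∃ N : ℕ → Submodule R P, iSupIndep N ∧ iSup N = D x ∧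
      ∀ n, IsNoetherian R (N n) := by
    intro x
    obtain ⟨s, hs, hspan⟩ := hcg x
    obtain ⟨N, hN, hNtop, hNn⟩ := (hP.of_injective (D x).subtype
      (D x).injective_subtype).exists_decomposition_nat (fun N hN => by
        have := hnoeth _ (hN.map (D x).subtype)
        exact isNoetherian_of_linearEquiv
          (Submodule.equivMapOfInjective (D x).subtype (D x).injective_subtype N).symm)
      ⟨(D x).subtype ⁻¹' s, hs.preimage (D x).injective_subtype, by
        apply Submodule.map_injective_of_injective (D x).injective_subtype
        rw [Submodule.map_span, Set.image_preimage_eq_of_subset, hspan, Submodule.map_top,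
          Submodule.range_subtype]
        rw [Submodule.coe_subtype, Subtype.range_coe, ← hspan]
        exact Submodule.subset_span⟩
    refine ⟨fun n => (N n).map (D x).subtype, ?_, ?_, fun n => ?_⟩
    · rw [iSupIndep_iff_finsetSum_eq_zero_imp_eq_zero]
      intro t v hv h
      choose! w hw hwv using hv
      have h0 := (iSupIndep_iff_finsetSum_eq_zero_imp_eq_zero N).1 hN t w hw (by
        apply (D x).injective_subtype
        rw [map_sum, Finset.sum_congr rfl hwv, h, map_zero])
      intro i hi
      rw [← hwv i hi, h0 i hi, map_zero]
    · rw [← Submodule.map_iSup, hNtop, Submodule.map_top, Submodule.range_subtype]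
    · have := hNn n
      exact isNoetherian_of_linearEquiv
        (Submodule.equivMapOfInjective (D x).subtype (D x).injective_subtype (N n))
  choose N hN hsup hNn using key
  refine ⟨fun k => N k.1 k.2, iSupIndep_sigma hD hN fun x n => ?_, ?_, fun k => hNn k.1 k.2⟩
  · rw [← hsup x]
    exact le_iSup (N x) n
  · rw [iSup_sigma, ← htop]
    exact iSup_congr hsup

end Decomposition

theorem proposition2p11 {R : Type u} [Ring R] {P : Type v} [AddCommGroup P] [Module Rᵐᵒᵖ P]
    (hP : IsHereditaryModule Rᵐᵒᵖ P)
    (hQ : ∀ x : P, ∃ (Q : Type w) (_ : AddCommGroup Q) (_ : Module Rᵐᵒᵖ Q)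
      (i : (Submodule.span Rᵐᵒᵖ {x} : Submodule Rᵐᵒᵖ P) →ₗ[Rᵐᵒᵖ] Q),
      IsQuasiInjectiveHull i ∧ IsCountablyGeneratedModule Rᵐᵒᵖ Q) :
    ∃ (ι : Type v) (_ : DecidableEq ι) (N : ι → Submodule Rᵐᵒᵖ P),
      DirectSum.IsInternal N ∧ (∀ k, IsNoetherian Rᵐᵒᵖ (N k)) ∧
      (IsCountablyGeneratedModule Rᵐᵒᵖ P → Countable ι) := by
  classical
  have hnoeth : ∀ N : Submodule Rᵐᵒᵖ P, N.FG → IsNoetherian Rᵐᵒᵖ N := by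
    intro N hN
    induction N, hN using Submodule.fg_induction with
    | singleton x =>
      obtain ⟨Q, _, _, i, hi, hcg⟩ := hQ x
      exact isNoetherian_span_singleton_of_hull hP x hi hcg
    | sup N₁ N₂ _ _ h₁ h₂ => exact isNoetherian_sup N₁ N₂
  by_cases hcg : IsCountablyGeneratedModule Rᵐᵒᵖ P
  · obtain ⟨N, hN, htop, hNn⟩ := hP.exists_decomposition_nat hnoeth hcg
    refine ⟨ULift.{v} ℕ, inferInstance, fun k => N k.down,
      DirectSum.isInternal_submodule_of_iSupIndep_of_iSup_eq_top
        (hN.comp ULift.down_injective) ?_, fun k => hNn _, fun _ => inferInstance⟩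
    rw [← htop]
    exact Equiv.ulift.iSup_comp (g := N)
  · obtain ⟨N, hN, htop, hNn⟩ := hP.exists_decomposition hnoeth
    exact ⟨_, inferInstance, N, DirectSum.isInternal_submodule_of_iSupIndep_of_iSup_eq_top hN htop,
      hNn, fun h => absurd h hcg⟩
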